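/- Let $\Omega\subseteq\mathbb R^2$ be open and let $P,Q,R,S,T,U,V,W:\Omega\to\mathbb R$ be smooth functions of $(x,y)$. Consider the system of two third-order ODEs (with $'=d/ds$) $$x'''+Px'^3+Qx'^2y'+Rx'y'^2+Sy'^3=0,\qquad y'''+Tx'^3+Ux'^2y'+Vx'y'^2+Wy'^3=0. \tag{1}$$ Consider further the following linear system for six unknowns $a,b,c,d,e,f$ at each point of $\Omega$: $$\begin{aligned} 3P_y-2aQ-2dR&=Q_x-6bP-2eQ, & 3T_y-2aU-2dV&=U_x-6bT-2eU,\\ Q_y-aR-3dS&=R_x-3cP-fQ, & U_y-aV-3dW&=V_x-3cT-fU,\\ R_y-2bR-6eS&=3S_x-2cQ-2fR, & V_y-2bV-6eW&=3W_x-2cU-2fV. \end{aligned}\tag{2}$$ Assume that its determinant $$\begin{vmatrix}2Q&-6P&0&2R&-2Q&0\\ R&0&-3P&3S&0&-Q\\ 0&2R&-2Q&0&6S&-2R\\ 2U&-6T&0&2V&-2U&0\\ V&0&-3T&3W&0&-U\\ 0&2V&-2U&0&6W&-2V\end{vmatrix}=-8\Delta$$ vanishes nowhere in $\Omega$, and let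 $a,b,c,d,e,f:\Omega\to\mathbb R$ be the unique solution of (2), given by Cramer's rule as explicit polynomials in $P,\dots,W$ and the six combinations $3P_y-Q_x$, $Q_y-R_x$, $R_y-3S_x$, $3T_y-U_x$, $U_y-V_x$, $V_y-3W_x$, divided by $\Delta$. Suppose that these functions satisfy on $\Omega$ the relations $$\begin{aligned} a_x&=-(P+2a^2+2bd), & a_y&=-(\tfrac13Q+2ab+2be),\\ b_x&=-(\tfrac13Q+cd+2ab+be), & b_y&=-(\tfrac13R+b^2+ac+ce+bf),\\ c_x&=-(\tfrac13R+2b^2+2ce), & c_y&=-(S+2bc+2cf),\\ d_x&=-(T+2ad+2de), & d_y&=-(\tfrac13U+2bd+2e^2),\\ e_x&=-(\tfrac13U+df+bd+ae+e^2), & e_y&=-(\tfrac13V+cd+be+2ef),\\ f_x&=-(\tfrac13V+2be+2ef), & f_y&=-(W+2ce+2f^2). \end{aligned}\tag{3}$$ (The determinant condition and (3) cannot both hold on a non-empty $\Omega$ if all eight coefficients are constant.) Then (1) is linearizable by a point transformation, subject to the second-order system $$x''=ax'^2+2bx'y'+cy'^2,\qquad y''=dx'^2+2ex'y'+fy'^2,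 \tag{4}$$ in the following sense. (i) $a,\dots,f$ are smooth, and (4) is flat on $\Omega$: the curvature tensor $R^i_{jkl}=\Gamma^i_{jl,k}-\Gamma^i_{jk,l}+\Gamma^i_{mk}\Gamma^m_{jl}-\Gamma^i_{ml}\Gamma^m_{jk}$ of $\Gamma^1_{11}=-a$, $\Gamma^1_{12}=\Gamma^1_{21}=-b$, $\Gamma^1_{22}=-c$, $\Gamma^2_{11}=-d$, $\Gamma^2_{12}=\Gamma^2_{21}=-e$, $\Gamma^2_{22}=-f$ vanishes; equivalently $a_y-b_x+be-cd=0$, $b_y-c_x+(ac-b^2)+(bf-ce)=0$, $d_y-e_x-(ae-bd)-(df-e^2)=0$ and $(b+f)_x=(a+e)_y$. (ii) (1) arises from (4) by differentiating (4) with respect to $s$ and eliminating $x'',y''$ by means of (4). (iii) Every point of $\Omega$ has an open neighbourhood $N\subseteq\Omega$ with a smooth diffeomorphism $\varphi=(u,v)$ from $N$ onto an open subset of $\mathbb R^2$ such that, on every open set $I\subseteq\mathbb R$, a $C^2$ curve $\gamma=(x,y):I\to N$ solves (4) if and only if $u''=v''=0$ along it; and such that, for every open interval $I$, every $s_0\in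 I$ and every $C^3$ curve $\gamma:I\to N$, the curve $\gamma$ solves (1) on $I$ and satisfies (4) at $s_0$ if and only if $u''=v''=0$ along it on all of $I$. -/

import Mathlib

open scoped ContDiff

namespace ThirdOrder

noncomputable section

/-- The plane of the dependent variables `(x, y)`. -/
abbrev Plane := ℝ × ℝ

/-- The partial derivative `∂f/∂x`. -/
def dx (f : Plane → ℝ) (p : Plane) : ℝ := fderiv ℝ f p (1, 0)

/-- The partial derivative `∂f/∂y`. -/
def dy (f : Plane → ℝ) (p : Plane) : ℝ := fderiv ℝ f p (0, 1)

/-- The partial derivative with respect to the `k`-th coordinate, `k = 0, 1`. -/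
def partialDeriv (k : Fin 2) : (Plane → ℝ) → Plane → ℝ := ![dx, dy] k

/-- The coefficients of the quadratically semi-linear second-order system
`x'' = a x'² + 2 b x' y' + c y'²`, `y'' = d x'² + 2 e x' y' + f y'²`. -/
structure QuadSystem where
  (a b c d e f : Plane → ℝ)

/-- The coefficients of the cubically semi-linear third-order system
`x''' + P x'³ + Q x'² y' + R x' y'² + S y'³ = 0`,
`y''' + T x'³ + U x'² y' + V x' y'² + W y'³ = 0`. -/
structure CubicSystem where
  (P Q R S T U V W : Plane → ℝ)

namespace QuadSystem

/-- All coefficients are smooth on `Ω`. -/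
def SmoothOn (G : QuadSystem) (Ω : Set Plane) : Prop :=
  ContDiffOn ℝ ∞ G.a Ω ∧ ContDiffOn ℝ ∞ G.b Ω ∧ ContDiffOn ℝ ∞ G.c Ω ∧
    ContDiffOn ℝ ∞ G.d Ω ∧ ContDiffOn ℝ ∞ G.e Ω ∧ ContDiffOn ℝ ∞ G.f Ω

/-- The right-hand side: the acceleration at the position `p` with the velocity `q`. -/
def accel (G : QuadSystem) (p q : Plane) : Plane :=
  (G.a p * q.1 ^ 2 + 2 * G.b p * q.1 * q.2 + G.c p * q.2 ^ 2,
   G.d p * q.1 ^ 2 + 2 * G.e p * q.1 * q.2 + G.f p * q.2 ^ 2)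

/-- `γ` is a `C²` solution of the second-order system on the open set `I`. -/
def IsSolutionOn (G : QuadSystem) (γ : ℝ → Plane) (I : Set ℝ) : Prop :=
  ContDiffOn ℝ 2 γ I ∧ ∀ s ∈ I, iteratedDeriv 2 γ s = G.accel (γ s) (deriv γ s)

/-- The Christoffel symbols `Γⁱⱼₖ`: the system reads `xⁱ'' + Γⁱⱼₖ xʲ' xᵏ' = 0`. -/
def christoffel (G : QuadSystem) (i j k : Fin 2) : Plane → ℝ :=
  ![![![-G.a, -G.b], ![-G.b, -G.c]], ![![-G.d, -G.e], ![-G.e, -G.f]]] i j k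

/-- The curvature tensor
`Rⁱⱼₖₗ = Γⁱⱼₗ,ₖ - Γⁱⱼₖ,ₗ + Γⁱₘₖ Γᵐⱼₗ - Γⁱₘₗ Γᵐⱼₖ`. -/
def riemann (G : QuadSystem) (i j k l : Fin 2) (p : Plane) : ℝ :=
  partialDeriv k (G.christoffel i j l) p - partialDeriv l (G.christoffel i j k) p
    + ∑ m, (G.christoffel i m k p * G.christoffel m j l p
      - G.christoffel i m l p * G.christoffel m j k p)

/-- The curvature tensor vanishes on `Ω`. -/
def IsFlatOn (G : QuadSystem) (Ω : Set Plane) : Prop :=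
  ∀ p ∈ Ω, ∀ i j k l, G.riemann i j k l p = 0

/-- The third derivative obtained by differentiating `z'' = G(z, z')` once along a curve and
eliminating `z''` by the same system: at `z = p`, `z' = q` it is the derivative of the right-hand
side in the direction `(z', z'') = (q, G(p, q))`. -/
def jerk (G : QuadSystem) (p q : Plane) : Plane :=
  fderiv ℝ (fun z : Plane × Plane => G.accel z.1 z.2) (p, q) (q, G.accel p q)

end QuadSystem

namespace CubicSystem

/-- All coefficients are smooth on `Ω`. -/
def SmoothOn (A : CubicSystem) (Ω : Set Plane) : Prop :=
  ContDiffOn ℝ ∞ A.P Ω ∧ ContDiffOn ℝ ∞ A.Q Ω ∧ ContDiffOn ℝ ∞ A.R Ω ∧ ContDiffOn ℝ ∞ A.S Ω ∧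
    ContDiffOn ℝ ∞ A.T Ω ∧ ContDiffOn ℝ ∞ A.U Ω ∧ ContDiffOn ℝ ∞ A.V Ω ∧ ContDiffOn ℝ ∞ A.W Ω

/-- The system solved for the third derivatives, at the position `p` with the velocity `q`. -/
def thirdDeriv (A : CubicSystem) (p q : Plane) : Plane :=
  (-(A.P p * q.1 ^ 3 + A.Q p * q.1 ^ 2 * q.2 + A.R p * q.1 * q.2 ^ 2 + A.S p * q.2 ^ 3),
   -(A.T p * q.1 ^ 3 + A.U p * q.1 ^ 2 * q.2 + A.V p * q.1 * q.2 ^ 2 + A.W p * q.2 ^ 3))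

/-- `γ` is a `C³` solution of the third-order system on the open set `I`. -/
def IsSolutionOn (A : CubicSystem) (γ : ℝ → Plane) (I : Set ℝ) : Prop :=
  ContDiffOn ℝ 3 γ I ∧ ∀ s ∈ I, iteratedDeriv 3 γ s = A.thirdDeriv (γ s) (deriv γ s)

/-- The third-order system arises, over `Ω`, from the second-order system `G` by differentiating
it and eliminating the second derivatives. -/
def ArisesFrom (A : CubicSystem) (G : QuadSystem) (Ω : Set Plane) : Prop :=
  ∀ p ∈ Ω, ∀ q : Plane, A.thirdDeriv p q = G.jerk p q

/-- The twelve relations that express the first derivatives of `a, …, f` through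
`a, …, f` and `P, …, W`. -/
def SatisfiesRelations (A : CubicSystem) (G : QuadSystem) (Ω : Set Plane) : Prop :=
  ∀ p ∈ Ω,
    dx G.a p = -(A.P p + 2 * G.a p ^ 2 + 2 * G.b p * G.d p) ∧
    dy G.a p = -(A.Q p / 3 + 2 * G.a p * G.b p + 2 * G.b p * G.e p) ∧
    dx G.b p = -(A.Q p / 3 + G.c p * G.d p + 2 * G.a p * G.b p + G.b p * G.e p) ∧
    dy G.b p = -(A.R p / 3 + G.b p ^ 2 + G.a p * G.c p + G.c p * G.e p + G.b p * G.f p) ∧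
    dx G.c p = -(A.R p / 3 + 2 * G.b p ^ 2 + 2 * G.c p * G.e p) ∧
    dy G.c p = -(A.S p + 2 * G.b p * G.c p + 2 * G.c p * G.f p) ∧
    dx G.d p = -(A.T p + 2 * G.a p * G.d p + 2 * G.d p * G.e p) ∧
    dy G.d p = -(A.U p / 3 + 2 * G.b p * G.d p + 2 * G.e p ^ 2) ∧
    dx G.e p = -(A.U p / 3 + G.d p * G.f p + G.b p * G.d p + G.a p * G.e p + G.e p ^ 2) ∧
    dy G.e p = -(A.V p / 3 + G.c p * G.d p + G.b p * G.e p + 2 * G.e p * G.f p) ∧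
    dx G.f p = -(A.V p / 3 + 2 * G.b p * G.e p + 2 * G.e p * G.f p) ∧
    dy G.f p = -(A.W p + 2 * G.c p * G.e p + 2 * G.f p ^ 2)

end CubicSystem

/-- The common denominator of the six formulas: `-1/8` times the determinant of the linear system
for `a, b, c, d, e, f` that is displayed in `CubicSystem.CompatibleAt`. -/
def cramerDelta (P Q R S T U V W : ℝ) : ℝ :=
  2 * (-R^3 * (U^3 - 27 * T^2 * W)
    - 9 * Q^2 * (2 * S * T + P * W) * (V^2 - 3 * U * W)
    + 27 * P * S * (S * U^3 - 3 * S * T * U * V - P * V^3 + 3 * P * U * V * W)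
    + Q^3 * (V^3 - 27 * T * W^2)
    + 3 * R^2 * (3 * S * T * (U^2 - 3 * T * V) + 6 * P * (U^2 - 3 * T * V) * W
      + Q * U * (U * V - 9 * T * W))
    + 27 * Q * S * (S * T * (-U^2 + 3 * T * V) + P * (U * V^2 - 2 * U^2 * W - 3 * T * V * W))
    + 3 * R * (Q^2 * V * (-U * V + 9 * T * W)
      - 3 * Q * (S * T - P * W) * (-U * V + 9 * T * W)
      + 9 * P * (P * W * (V^2 - 3 * U * W) + S * (-U^2 * V + 2 * T * V^2 + 3 * T * U * W))))

/-- The numerator of `a`. -/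
def cramerNumA (P Q R S T U V W r₁ r₂ r₃ r₄ r₅ r₆ : ℝ) : ℝ :=
  3 * (-9 * S^2 * T * U^2 + R * S * U^3 + 27 * S^2 * T^2 * V - Q * S * U^2 * V -
      3 * Q * S * T * V^2 + 3 * P * S * U * V^2 - 27 * R * S * T^2 * W +
      18 * Q * S * T * U * W - Q * R * U^2 * W + 3 * Q * R * T * V * W -
      27 * P * S * T * V * W + Q^2 * U * V * W - 3 * P * R * U * V * W - 9 * Q^2 * T * W^2 +
      27 * P * R * T * W^2) * r₁
    + 2 * (9 * R * S * T * U^2 - R^2 * U^3 - 27 * R * S * T^2 * V + 2 * Q * R * U^2 * V -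
      9 * P * S * U^2 * V + 27 * P * S * T * V^2 - Q^2 * U * V^2 + 27 * R^2 * T^2 * W -
      18 * Q * R * T * U * W + 9 * P * R * U^2 * W + 9 * Q^2 * T * V * W -
      27 * P * R * T * V * W) * r₂
    + 3 * (Q * T - P * U) * (-3 * S * U^2 + 9 * S * T * V + R * U * V - Q * V^2 -
      9 * R * T * W + 3 * Q * U * W) * r₃
    - 3 * (Q * R * S * U^2 - 9 * P * S^2 * U^2 - 3 * Q * R * S * T * V + 27 * P * S^2 * T * V
      - Q^2 * S * U * V + 3 * P * R * S * U * V + 3 * Q * R^2 * T * W - 27 * P * R * S * T * W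
      - Q^2 * R * U * W - 3 * P * R^2 * U * W + 18 * P * Q * S * U * W + Q^3 * V * W -
      27 * P^2 * S * V * W - 9 * P * Q^2 * W^2 + 27 * P^2 * R * W^2) * r₄
    + 2 * (Q * R^2 * U^2 - 9 * P * R * S * U^2 - 9 * Q^2 * S * T * V + 27 * P * R * S * T * V
      - 2 * Q^2 * R * U * V + 18 * P * Q * S * U * V + Q^3 * V^2 - 27 * P^2 * S * V^2 +
      9 * Q^2 * R * T * W - 27 * P * R^2 * T * W - 9 * P * Q^2 * V * W +
      27 * P^2 * R * V * W) * r₅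
    - 3 * (Q * T - P * U) * (R^2 * U - 3 * Q * S * U - Q * R * V + 9 * P * S * V + 3 * Q^2 * W
      - 9 * P * R * W) * r₆

/-- The numerator of `b`. -/
def cramerNumB (P Q R S T U V W r₁ r₂ r₃ r₄ r₅ r₆ : ℝ) : ℝ :=
  -3 * (3 * S^2 * U^3 - 9 * S^2 * T * U * V - 2 * R * S * U^2 * V + 3 * R * S * T * V^2 +
      2 * Q * S * U * V^2 - 3 * P * S * V^3 + 9 * R * S * T * U * W + R^2 * U^2 * W -
      6 * Q * S * U^2 * W - 3 * R^2 * T * V * W + 9 * P * S * U * V * W - Q^2 * V^2 * W +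
      3 * P * R * V^2 * W + 3 * Q^2 * U * W^2 - 9 * P * R * U * W^2) * r₁
    - 2 * (R * U - Q * V) * (-3 * S * U^2 + 9 * S * T * V + R * U * V - Q * V^2 -
      9 * R * T * W + 3 * Q * U * W) * r₂
    - (R * U - Q * V) * (R * U^2 - 3 * R * T * V - Q * U * V + 3 * P * V^2 + 9 * Q * T * W -
      9 * P * U * W) * r₃
    - 3 * (R^2 * S * U^2 - 3 * Q * S^2 * U^2 - 3 * R^2 * S * T * V + 9 * Q * S^2 * T * V -
      Q^2 * S * V^2 + 3 * P * R * S * V^2 + 3 * R^3 * T * W - 9 * Q * R * S * T * W -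
      2 * Q * R^2 * U * W + 6 * Q^2 * S * U * W + 2 * Q^2 * R * V * W - 3 * P * R^2 * V * W -
      9 * P * Q * S * V * W - 3 * Q^3 * W^2 + 9 * P * Q * R * W^2) * r₄
    + 2 * (R * U - Q * V) * (R^2 * U - 3 * Q * S * U - Q * R * V + 9 * P * S * V + 3 * Q^2 * W
      - 9 * P * R * W) * r₅
    - (R * U - Q * V) * (3 * R^2 * T - 9 * Q * S * T - Q * R * U + 9 * P * S * U + Q^2 * V -
      3 * P * R * V) * r₆

/-- The numerator of `c`. -/
def cramerNumC (P Q R S T U V W r₁ r₂ r₃ r₄ r₅ r₆ : ℝ) : ℝ :=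
  -3 * (S * V - R * W) * (3 * S * U^2 - 9 * S * T * V - R * U * V + Q * V^2 + 9 * R * T * W -
      3 * Q * U * W) * r₁
    - 6 * (-S * V + R * W) * (R * U^2 - 3 * R * T * V - Q * U * V + 3 * P * V^2 +
      9 * Q * T * W - 9 * P * U * W) * r₂
    - (R^2 * U^2 * V - 9 * Q * S * T * V^2 - 2 * Q * R * U * V^2 + 9 * P * S * U * V^2 +
      Q^2 * V^3 - 9 * R^2 * T * U * W + 27 * Q * S * T * U * W - 27 * P * S * U^2 * W +
      18 * Q * R * T * V * W - 9 * P * Q * V^2 * W - 27 * Q^2 * T * W^2 +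
      27 * P * Q * U * W^2) * r₃
    + 3 * (-S * V + R * W) * (R^2 * U - 3 * Q * S * U - Q * R * V + 9 * P * S * V +
      3 * Q^2 * W - 9 * P * R * W) * r₄
    - 6 * (3 * R^2 * T - 9 * Q * S * T - Q * R * U + 9 * P * S * U + Q^2 * V -
      3 * P * R * V) * (-S * V + R * W) * r₅
    + (-9 * R^2 * S * T * U + 27 * Q * S^2 * T * U + R^3 * U^2 - 27 * P * S^2 * U^2 -
      2 * Q * R^2 * U * V + 18 * P * R * S * U * V + Q^2 * R * V^2 - 9 * P * Q * S * V^2 +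
      9 * Q * R^2 * T * W - 27 * Q^2 * S * T * W - 9 * P * R^2 * U * W +
      27 * P * Q * S * U * W) * r₆

/-- The numerator of `d`. -/
def cramerNumD (P Q R S T U V W r₁ r₂ r₃ r₄ r₅ r₆ : ℝ) : ℝ :=
  (9 * R * S * T * U^2 - R^2 * U^3 - 27 * R * S * T^2 * V + 2 * Q * R * U^2 * V -
      9 * P * S * U^2 * V + 27 * P * S * T * V^2 - Q^2 * U * V^2 + 27 * R^2 * T^2 * W -
      18 * Q * R * T * U * W + 9 * P * R * U^2 * W + 9 * Q^2 * T * V * W -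
      27 * P * R * T * V * W) * r₁
    + 6 * (Q * T - P * U) * (-3 * S * U^2 + 9 * S * T * V + R * U * V - Q * V^2 -
      9 * R * T * W + 3 * Q * U * W) * r₂
    + 3 * (Q * T - P * U) * (R * U^2 - 3 * R * T * V - Q * U * V + 3 * P * V^2 + 9 * Q * T * W
      - 9 * P * U * W) * r₃
    + (Q * R^2 * U^2 - 9 * P * R * S * U^2 - 9 * Q^2 * S * T * V + 27 * P * R * S * T * V -
      2 * Q^2 * R * U * V + 18 * P * Q * S * U * V + Q^3 * V^2 - 27 * P^2 * S * V^2 +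
      9 * Q^2 * R * T * W - 27 * P * R^2 * T * W - 9 * P * Q^2 * V * W +
      27 * P^2 * R * V * W) * r₄
    - 6 * (Q * T - P * U) * (R^2 * U - 3 * Q * S * U - Q * R * V + 9 * P * S * V + 3 * Q^2 * W
      - 9 * P * R * W) * r₅
    + 3 * (Q * T - P * U) * (3 * R^2 * T - 9 * Q * S * T - Q * R * U + 9 * P * S * U + Q^2 * V
      - 3 * P * R * V) * r₆

/-- The numerator of `e`. -/
def cramerNumE (P Q R S T U V W r₁ r₂ r₃ r₄ r₅ r₆ : ℝ) : ℝ :=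
  -(R * U - Q * V) * (-3 * S * U^2 + 9 * S * T * V + R * U * V - Q * V^2 - 9 * R * T * W +
      3 * Q * U * W) * r₁
    - 2 * (R * U - Q * V) * (R * U^2 - 3 * R * T * V - Q * U * V + 3 * P * V^2 + 9 * Q * T * W
      - 9 * P * U * W) * r₂
    - 3 * (-R^2 * T * U^2 + 3 * Q * S * T * U^2 - 3 * P * S * U^3 + 3 * R^2 * T^2 * V -
      9 * Q * S * T^2 * V + 9 * P * S * T * U * V + 2 * P * R * U^2 * V + Q^2 * T * V^2 -
      6 * P * R * T * V^2 - 2 * P * Q * U * V^2 + 3 * P^2 * V^3 - 3 * Q^2 * T * U * W +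
      3 * P * Q * U^2 * W + 9 * P * Q * T * V * W - 9 * P^2 * U * V * W) * r₃
    + (R * U - Q * V) * (R^2 * U - 3 * Q * S * U - Q * R * V + 9 * P * S * V + 3 * Q^2 * W -
      9 * P * R * W) * r₄
    - 2 * (R * U - Q * V) * (3 * R^2 * T - 9 * Q * S * T - Q * R * U + 9 * P * S * U + Q^2 * V
      - 3 * P * R * V) * r₅
    + 3 * (3 * R^3 * T^2 - 9 * Q * R * S * T^2 - 2 * Q * R^2 * T * U + 3 * Q^2 * S * T * U +
      9 * P * R * S * T * U + P * R^2 * U^2 - 3 * P * Q * S * U^2 + 2 * Q^2 * R * T * V -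
      6 * P * R^2 * T * V - P * Q^2 * V^2 + 3 * P^2 * R * V^2 - 3 * Q^3 * T * W +
      9 * P * Q * R * T * W + 3 * P * Q^2 * U * W - 9 * P^2 * R * U * W) * r₆

/-- The numerator of `f`. -/
def cramerNumF (P Q R S T U V W r₁ r₂ r₃ r₄ r₅ r₆ : ℝ) : ℝ :=
  3 * (S * V - R * W) * (R * U^2 - 3 * R * T * V - Q * U * V + 3 * P * V^2 + 9 * Q * T * W -
      9 * P * U * W) * r₁
    - 2 * (R^2 * U^2 * V - 9 * Q * S * T * V^2 - 2 * Q * R * U * V^2 + 9 * P * S * U * V^2 +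
      Q^2 * V^3 - 9 * R^2 * T * U * W + 27 * Q * S * T * U * W - 27 * P * S * U^2 * W +
      18 * Q * R * T * V * W - 9 * P * Q * V^2 * W - 27 * Q^2 * T * W^2 +
      27 * P * Q * U * W^2) * r₂
    - 3 * (-R^2 * T * U * V + 3 * Q * S * T * U * V - 3 * P * S * U^2 * V + Q * R * T * V^2 +
      P * R * U * V^2 - P * Q * V^3 + 9 * R^2 * T^2 * W - 27 * Q * S * T^2 * W -
      3 * Q * R * T * U * W + 27 * P * S * T * U * W + 3 * P * R * U^2 * W -
      18 * P * R * T * V * W + 9 * P^2 * V^2 * W + 27 * P * Q * T * W^2 -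
      27 * P^2 * U * W^2) * r₃
    - 3 * (3 * R^2 * T - 9 * Q * S * T - Q * R * U + 9 * P * S * U + Q^2 * V -
      3 * P * R * V) * (-S * V + R * W) * r₄
    + 2 * (-9 * R^2 * S * T * U + 27 * Q * S^2 * T * U + R^3 * U^2 - 27 * P * S^2 * U^2 -
      2 * Q * R^2 * U * V + 18 * P * R * S * U * V + Q^2 * R * V^2 - 9 * P * Q * S * V^2 +
      9 * Q * R^2 * T * W - 27 * Q^2 * S * T * W - 9 * P * R^2 * U * W +
      27 * P * Q * S * U * W) * r₅
    - 3 * (-9 * R^2 * S * T^2 + 27 * Q * S^2 * T^2 + R^3 * T * U - 27 * P * S^2 * T * U -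
      Q * R^2 * T * V - 3 * Q^2 * S * T * V + 18 * P * R * S * T * V - P * R^2 * U * V +
      3 * P * Q * S * U * V + P * Q * R * V^2 - 9 * P^2 * S * V^2 + 3 * Q^2 * R * T * W -
      27 * P * Q * S * T * W - 3 * P * Q * R * U * W + 27 * P^2 * S * U * W) * r₆

namespace CubicSystem

/-- The denominator `Δ` as a function on the plane. -/
def delta (A : CubicSystem) (p : Plane) : ℝ :=
  cramerDelta (A.P p) (A.Q p) (A.R p) (A.S p) (A.T p) (A.U p) (A.V p) (A.W p)

/-- A numerator, evaluated at the coefficients and at the combinations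
`3P_y - Q_x`, `Q_y - R_x`, `R_y - 3S_x`, `3T_y - U_x`, `U_y - V_x`, `V_y - 3W_x`. -/
def evalNum (A : CubicSystem)
    (N : ℝ → ℝ → ℝ → ℝ → ℝ → ℝ → ℝ → ℝ → ℝ → ℝ → ℝ → ℝ → ℝ → ℝ → ℝ) (p : Plane) : ℝ :=
  N (A.P p) (A.Q p) (A.R p) (A.S p) (A.T p) (A.U p) (A.V p) (A.W p)
    (3 * dy A.P p - dx A.Q p) (dy A.Q p - dx A.R p) (dy A.R p - 3 * dx A.S p)
    (3 * dy A.T p - dx A.U p) (dy A.U p - dx A.V p) (dy A.V p - 3 * dx A.W p)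

/-- The functions `a, …, f` given by the explicit Cramer-rule formulas. -/
def cramerCoeffs (A : CubicSystem) : QuadSystem where
  a p := 1 / A.delta p * A.evalNum cramerNumA p
  b p := 1 / A.delta p * A.evalNum cramerNumB p
  c p := 1 / A.delta p * A.evalNum cramerNumC p
  d p := 1 / A.delta p * A.evalNum cramerNumD p
  e p := 1 / A.delta p * A.evalNum cramerNumE p
  f p := 1 / A.delta p * A.evalNum cramerNumF p

/-- The linear system for `a, …, f` at the point `p`. -/
def CompatibleAt (A : CubicSystem) (G : QuadSystem) (p : Plane) : Prop :=
  3 * dy A.P p - 2 * G.a p * A.Q p - 2 * G.d p * A.R p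
      = dx A.Q p - 6 * G.b p * A.P p - 2 * G.e p * A.Q p ∧
  dy A.Q p - G.a p * A.R p - 3 * G.d p * A.S p
      = dx A.R p - 3 * G.c p * A.P p - G.f p * A.Q p ∧
  dy A.R p - 2 * G.b p * A.R p - 6 * G.e p * A.S p
      = 3 * dx A.S p - 2 * G.c p * A.Q p - 2 * G.f p * A.R p ∧
  3 * dy A.T p - 2 * G.a p * A.U p - 2 * G.d p * A.V p
      = dx A.U p - 6 * G.b p * A.T p - 2 * G.e p * A.U p ∧
  dy A.U p - G.a p * A.V p - 3 * G.d p * A.W p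
      = dx A.V p - 3 * G.c p * A.T p - G.f p * A.U p ∧
  dy A.V p - 2 * G.b p * A.V p - 6 * G.e p * A.W p
      = 3 * dx A.W p - 2 * G.c p * A.U p - 2 * G.f p * A.V p

/-- The explicit formulas do solve the linear system wherever `Δ ≠ 0`. -/
theorem cramerCoeffs_solves (A : CubicSystem) (p : Plane) (h : A.delta p ≠ 0) :
    A.CompatibleAt A.cramerCoeffs p := by
  simp only [CompatibleAt, cramerCoeffs]
  generalize hD : A.delta p = D at h
  simp only [delta, cramerDelta] at hD
  refine ⟨?_, ?_, ?_, ?_, ?_, ?_⟩ <;>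
  · field_simp
    subst hD
    simp only [evalNum, cramerNumA, cramerNumB, cramerNumC, cramerNumD, cramerNumE, cramerNumF]
    ring

end CubicSystem

/-- The point transformation `(x, y) ↦ (u, v) = φ(x, y)` carries the second-order system `G` to
`u'' = 0, v'' = 0`. -/
def LinearizesQuad (φ : OpenPartialHomeomorph Plane Plane) (G : QuadSystem) : Prop :=
  ∀ (I : Set ℝ) (γ : ℝ → Plane), IsOpen I → ContDiffOn ℝ 2 γ I → Set.MapsTo γ I φ.source →
    (G.IsSolutionOn γ I ↔ ∀ s ∈ I, iteratedDeriv 2 (φ ∘ γ) s = 0)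

/-- The point transformation `φ` carries the third-order system `A`, subject to the second-order
system `G` as a condition on the initial data at one instant, to `u'' = 0, v'' = 0`. -/
def LinearizesCubic (φ : OpenPartialHomeomorph Plane Plane) (A : CubicSystem) (G : QuadSystem) :
    Prop :=
  ∀ (I : Set ℝ) (γ : ℝ → Plane), IsOpen I → IsPreconnected I → ContDiffOn ℝ 3 γ I →
    Set.MapsTo γ I φ.source → ∀ s₀ ∈ I,
    ((A.IsSolutionOn γ I ∧ iteratedDeriv 2 γ s₀ = G.accel (γ s₀) (deriv γ s₀)) ↔
      ∀ s ∈ I, iteratedDeriv 2 (φ ∘ γ) s = 0)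

/-- The third-order system `A` is (conditionally) linearizable over `Ω`, subject to the
second-order system `G`: `G` is smooth and flat, `A` arises from it by differentiation and
elimination of the second derivatives, and near every point there is a point transformation (a
smooth diffeomorphism between open sets) that linearizes `G`, and `A` subject to `G`. -/
def CubicSystem.IsLinearizableSubjectTo (A : CubicSystem) (G : QuadSystem) (Ω : Set Plane) :
    Prop :=
  G.SmoothOn Ω ∧ G.IsFlatOn Ω ∧ A.ArisesFrom G Ω ∧
    ∀ p₀ ∈ Ω, ∃ φ : OpenPartialHomeomorph Plane Plane,
      p₀ ∈ φ.source ∧ φ.source ⊆ Ω ∧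
      ContDiffOn ℝ ∞ φ φ.source ∧ ContDiffOn ℝ ∞ φ.symm φ.target ∧
      LinearizesQuad φ G ∧ LinearizesCubic φ A G

end

end ThirdOrder

set_option maxSynthPendingDepth 3

open Set Metric Filter Topology

/-! The relations (3) encode two facts about the connection `Γ` of (4). In the differences `a_y -
b_x`, `b_y - c_x`, `d_y - e_x`, `e_y - f_x` the coefficients `Q`, `R`, `U`, `V` cancel, and what
remains is the vanishing of the curvature (`SatisfiesRelations.isFlatOn`). In the symmetrized
combinations, such as `a_y + 2 b_x`, the thirds add up to `Q`, and what remains is that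
differentiating (4) gives (1) (`SatisfiesRelations.arisesFrom`). The Cramer formulas themselves
matter only for smoothness: they are polynomials divided by the nonvanishing `Δ`.

A flat torsion-free connection has local affine coordinates. They are maps `u` with `du = J` and `dJ
= J ∘ Γ`, a linear total differential equation for `(u, J)` that is integrable exactly because `Γ`
is symmetric and flat. Its solution comes from a Frobenius theorem (`exists_parallel_section`):
solve the equation along the rays from `p₀`, then show by a Grönwall estimate that the resulting
function satisfies it in every direction. Where `J` is invertible, `u` is a chart
(`exists_affine_chart`), and `(u ∘ γ)'' = J (γ'' + Γ(γ', γ'))` shows that it linearizes (4).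

For (1), the deviation `γ'' - G(γ, γ')` of a solution from (4) obeys a homogeneous linear equation
in `s`. It therefore vanishes on the whole interval once it vanishes at `s₀`
(`second_order_of_third_order`). -/

/-! ### Linear differential equations with small coefficients -/

theorem Real.exp_half_lt_two : Real.exp (1 / 2) < 2 := by
  have h : Real.exp (1 / 2) * Real.exp (1 / 2) = Real.exp 1 := by
    rw [← Real.exp_add]; norm_num
  nlinarith [Real.exp_one_lt_d9, Real.exp_pos (1 / 2)]

/-- The linear equation `v' = B t v` with `‖B‖ ≤ 1/2` has a solution on `[0, 1]`. -/
theorem exists_solution_linear_ode {F : Type*} [NormedAddCommGroup F] [NormedSpace ℝ F]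
    [CompleteSpace F] (B : ℝ → F →L[ℝ] F) (hB : ContinuousOn B (Icc 0 1))
    (hB' : ∀ t ∈ Icc (0 : ℝ) 1, ‖B t‖ ≤ 1 / 2) (v₀ : F) :
    ∃ v : ℝ → F, v 0 = v₀ ∧ (∀ t ∈ Icc (0 : ℝ) 1, HasDerivWithinAt v (B t (v t)) (Icc 0 1) t) ∧
      ∀ t ∈ Icc (0 : ℝ) 1, ‖v t‖ ≤ 2 * ‖v₀‖ := by
  -- On the ball of radius `‖v₀‖` about `v₀` one has `‖x‖ ≤ 2 ‖v₀‖`, so the field is bounded by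
  -- `‖v₀‖` and a solution cannot leave the ball before time 1.
  have hPL : IsPicardLindelof (fun t v => B t v) (⟨0, by simp⟩ : Icc (0 : ℝ) 1) v₀ ‖v₀‖₊ 0
      ‖v₀‖₊ (1 / 2) := by
    refine ⟨fun t ht => ?_, fun x _ => hB.clm_apply continuousOn_const, fun t ht x hx => ?_, ?_⟩
    · refine ((B t).lipschitz.weaken ?_).lipschitzOnWith
      rw [← NNReal.coe_le_coe]
      simpa using hB' t ht
    · have h1 : ‖x‖ ≤ ‖v₀‖ + ‖v₀‖ := by
        have := norm_le_norm_add_norm_sub' x v₀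
        rw [mem_closedBall, dist_eq_norm] at hx
        simp only [coe_nnnorm] at hx
        linarith
      have h2 := (B t).le_of_opNorm_le (hB' t ht) x
      simp only [coe_nnnorm]
      linarith
    · simp
  obtain ⟨v, hv0, hv⟩ := hPL.exists_eq_forall_mem_Icc_hasDerivWithinAt₀
  refine ⟨v, hv0, hv, fun t ht => ?_⟩
  have hg := norm_le_gronwallBound_of_norm_deriv_right_le (f := v) (f' := fun t => B t (v t))
    (δ := ‖v₀‖) (K := 1 / 2) (ε := 0) (a := 0) (b := 1)
    (fun t ht => (hv t ht).continuousWithinAt)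
    (fun t ht => (hv t ⟨ht.1, ht.2.le⟩).mono_of_mem_nhdsWithin (Icc_mem_nhdsGE_of_mem ht))
    (by simp [← hv0])
    (fun t ht => by simpa using (B t).le_of_opNorm_le (hB' t ⟨ht.1, ht.2.le⟩) (v t)) t ht
  rw [gronwallBound_ε0] at hg
  have h1 : Real.exp (1 / 2 * (t - 0)) ≤ 2 :=
    (Real.exp_le_exp.2 (by linarith [ht.2])).trans Real.exp_half_lt_two.le
  nlinarith [norm_nonneg v₀]

/-! ### Frobenius' theorem for linear total differential equations -/

section Frobenius

variable {E F : Type*} [NormedAddCommGroup E] [NormedSpace ℝ E]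
  [NormedAddCommGroup F] [NormedSpace ℝ F]

/-- A `C²` function and its derivative are bounded and the derivative is Lipschitz near a point. -/
theorem ContDiffAt.exists_ball_bounds {f : E → F} {p₀ : E} (hf : ContDiffAt ℝ 2 f p₀) :
    ∃ C > 0, ∃ r > 0, (∀ p ∈ ball p₀ r, DifferentiableAt ℝ f p) ∧
      (∀ p ∈ ball p₀ r, ‖f p‖ ≤ C) ∧ (∀ p ∈ ball p₀ r, ‖fderiv ℝ f p‖ ≤ C) ∧
      ∀ p ∈ ball p₀ r, ∀ q ∈ ball p₀ r, ‖fderiv ℝ f p - fderiv ℝ f q‖ ≤ C * ‖p - q‖ := by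
  have hd : ContDiffAt ℝ 1 (fderiv ℝ f) p₀ := hf.fderiv_right (by norm_num)
  obtain ⟨K, t, ht, hK⟩ := hd.exists_lipschitzOnWith
  have h1 : ∀ᶠ p in 𝓝 p₀, ‖f p‖ < ‖f p₀‖ + 1 :=
    hf.continuousAt.norm.eventually_lt continuousAt_const (by simp)
  have h2 : ∀ᶠ p in 𝓝 p₀, ‖fderiv ℝ f p‖ < ‖fderiv ℝ f p₀‖ + 1 :=
    hd.continuousAt.norm.eventually_lt continuousAt_const (by simp)
  have h3 : ∀ᶠ p in 𝓝 p₀, DifferentiableAt ℝ f p :=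
    (hf.eventually (by simp)).mono fun p hp => hp.differentiableAt (by norm_num)
  obtain ⟨r, hr, H⟩ := Metric.eventually_nhds_iff_ball.1
    (h1.and (h2.and (h3.and (eventually_mem_set.2 ht))))
  have hn1 := norm_nonneg (f p₀)
  have hn2 := norm_nonneg (fderiv ℝ f p₀)
  refine ⟨‖f p₀‖ + ‖fderiv ℝ f p₀‖ + K + 1, by positivity, r, hr, fun p hp => (H p hp).2.2.1,
    fun p hp => ?_, fun p hp => ?_, fun p hp q hq => ?_⟩
  · linarith [(H p hp).1, K.2]
  · linarith [(H p hp).2.1, K.2]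
  · have := hK.dist_le_mul p (H p hp).2.2.2 q (H q hq).2.2.2
    rw [dist_eq_norm, dist_eq_norm] at this
    refine this.trans ?_
    gcongr
    linarith

/-- Here `X`, `Y` are the values of `M` at `p₀ + t q` and `p₀ + t (q + h)`, and `N` is the
derivative of `M` at the former. Flatness `hN` turns the derivative in direction `q` into one in
direction `h`, which pairs with `Y - X`. Apart from the term in the defect `u - v - t • X h v`, the
right-hand side is then of second order in `h`. -/
theorem parallel_defect_identity (X Y : E →L[ℝ] F →L[ℝ] F) (N : E →L[ℝ] E →L[ℝ] F →L[ℝ] F)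
    (q h : E) (t : ℝ) (v u : F) (hN : N h q v + X q (X h v) = N q h v + X h (X q v)) :
    Y (q + h) u - X q v - (X h v + t • (N q h v + X h (X q v))) =
      Y (q + h) (u - v - t • X h v) + ((Y - X - t • N h) (q + h) v + t • N h h v +
        t • ((Y - X) (q + h) (X h v) + X h (X h v))) := by
  rw [← hN]
  simp only [map_add, map_sub, map_smul, sub_apply, add_apply, smul_apply]
  module

theorem norm_parallel_defect_le {X Y : E →L[ℝ] F →L[ℝ] F} {N : E →L[ℝ] E →L[ℝ] F →L[ℝ] F}
    {q h : E} {t : ℝ} {v u : F} (hN : N h q v + X q (X h v) = N q h v + X h (X q v))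
    {C c : ℝ} (_hC : 0 ≤ C) (hX : ‖X‖ ≤ C) (hNC : ‖N‖ ≤ C) (hYX : ‖Y - X‖ ≤ C * ‖h‖)
    (he : ‖Y - X - t • N h‖ ≤ C * ‖h‖ * ‖h‖) (hqh : ‖q + h‖ ≤ 1)
    (hY : ‖Y (q + h)‖ ≤ 1 / 2) (ht : ‖t‖ ≤ 1) (hv : ‖v‖ ≤ c) :
    ‖Y (q + h) u - X q v - (X h v + t • (N q h v + X h (X q v)))‖ ≤
      1 / 2 * ‖u - v - t • X h v‖ + (C + C + (C + C) * C) * c * ‖h‖ ^ 2 := by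
  have hw : ‖X h v‖ ≤ C * ‖h‖ * c := (X h).le_of_opNorm_le_of_le (X.le_of_opNorm_le hX h) hv
  have i0 : ‖Y (q + h) (u - v - t • X h v)‖ ≤ 1 / 2 * ‖u - v - t • X h v‖ :=
    (Y (q + h)).le_of_opNorm_le hY _
  have i1 : ‖(Y - X - t • N h) (q + h) v‖ ≤ C * ‖h‖ * ‖h‖ * 1 * c :=
    ((Y - X - t • N h) (q + h)).le_of_opNorm_le_of_le
      ((Y - X - t • N h).le_of_opNorm_le_of_le he hqh) hv
  have i2 : ‖t • N h h v‖ ≤ 1 * (C * ‖h‖ * ‖h‖ * c) := by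
    rw [norm_smul]
    gcongr
    exact (N h h).le_of_opNorm_le_of_le ((N h).le_of_opNorm_le (N.le_of_opNorm_le hNC h) h) hv
  have i3 : ‖t • ((Y - X) (q + h) (X h v) + X h (X h v))‖ ≤
      1 * (C * ‖h‖ * 1 * (C * ‖h‖ * c) + C * ‖h‖ * (C * ‖h‖ * c)) := by
    rw [norm_smul]
    gcongr
    refine norm_add_le_of_le ?_ ?_
    · exact ((Y - X) (q + h)).le_of_opNorm_le_of_le ((Y - X).le_of_opNorm_le_of_le hYX hqh) hw
    · exact (X h).le_of_opNorm_le_of_le (X.le_of_opNorm_le hX h) hw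
  rw [parallel_defect_identity X Y N q h t v u hN]
  refine (norm_add_le_of_le i0 (norm_add_le_of_le (norm_add_le_of_le i1 i2) i3)).trans (le_of_eq ?_)
  ring

/-- Solutions of a total differential equation `dw = M w` are as smooth as `M`. -/
theorem contDiffOn_of_hasFDerivAt_flip {M : E → E →L[ℝ] F →L[ℝ] F} {s : Set E} (hs : IsOpen s)
    (hM : ContDiffOn ℝ ∞ M s) {w : E → F}
    (hw : ∀ p ∈ s, HasFDerivAt w ((M p).flip (w p)) p) : ContDiffOn ℝ ∞ w s := by
  rw [contDiffOn_infty]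
  intro n
  induction n with
  | zero =>
    exact contDiffOn_zero.2 fun p hp => (hw p hp).continuousAt.continuousWithinAt
  | succ n ih =>
    push_cast
    rw [contDiffOn_succ_iff_fderiv_of_isOpen hs]
    refine ⟨fun p hp => (hw p hp).differentiableAt.differentiableWithinAt, by simp, ?_⟩
    have h0 : ContDiffOn ℝ n (fun p => (M p).flip) s :=
      (ContinuousLinearMap.flipₗᵢ ℝ E F F).toContinuousLinearEquiv.contDiff.comp_contDiffOn
        (contDiffOn_infty.1 hM n)
    have h1 : ContDiffOn ℝ n (fun p => (M p).flip (w p)) s := h0.clm_apply ih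
    exact h1.congr fun p hp => (hw p hp).fderiv

variable [CompleteSpace F]

/-- Frobenius' theorem for a linear total differential equation `dw = M w`: a flat connection of
class `C²` has a parallel section with any prescribed value at a point. -/
theorem exists_parallel_section (M : E → E →L[ℝ] F →L[ℝ] F) {Ω : Set E}
    (hΩ : IsOpen Ω) (hM : ContDiffOn ℝ 2 M Ω)
    (hflat : ∀ p ∈ Ω, ∀ (h k : E) (v : F),
      fderiv ℝ M p h k v + M p k (M p h v) = fderiv ℝ M p k h v + M p h (M p k v))
    {p₀ : E} (hp₀ : p₀ ∈ Ω) (v₀ : F) :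
    ∃ r > 0, ball p₀ r ⊆ Ω ∧ ∃ w : E → F, w p₀ = v₀ ∧
      ∀ p ∈ ball p₀ r, HasFDerivAt w ((M p).flip (w p)) p := by
  obtain ⟨C, hC, r₁, hr₁, hdiff, hM0, hM1, hM2⟩ :=
    (hM.contDiffAt (hΩ.mem_nhds hp₀)).exists_ball_bounds
  obtain ⟨r₂, hr₂, hsub⟩ := Metric.isOpen_iff.1 hΩ p₀ hp₀
  -- Each bound has its use: `r₁` for the estimates on `M`, `r₂` to stay in `Ω`, 1 for `‖q + h‖ ≤
  -- 1`, and `1 / (2 * C)` for `‖M q‖ ≤ 1 / 2` along rays.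
  set r := min (min r₁ r₂) (min 1 (1 / (2 * C))) with hr
  have hrpos : 0 < r := by positivity
  have hr1 : r ≤ 1 := (min_le_right _ _).trans (min_le_left _ _)
  have hrC : C * r ≤ 1 / 2 := by
    have : r ≤ 1 / (2 * C) := (min_le_right _ _).trans (min_le_right _ _)
    calc C * r ≤ C * (1 / (2 * C)) := by gcongr
      _ = 1 / 2 := by field_simp
  have hB1 : ball p₀ r ⊆ ball p₀ r₁ :=
    ball_subset_ball ((min_le_left _ _).trans (min_le_left _ _))
  have hB2 : ball p₀ r ⊆ Ω :=
    (ball_subset_ball ((min_le_left _ _).trans (min_le_right _ _))).trans hsub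
  have hray : ∀ q : E, p₀ + q ∈ ball p₀ r → ∀ t ∈ Icc (0 : ℝ) 1, p₀ + t • q ∈ ball p₀ r := by
    intro q hq t ht
    rw [mem_ball, dist_eq_norm, add_sub_cancel_left] at hq ⊢
    rw [norm_smul, Real.norm_of_nonneg ht.1]
    nlinarith [norm_nonneg q, ht.2]
  have hline : ∀ q : E, p₀ + q ∈ ball p₀ r → ∀ t ∈ Icc (0 : ℝ) 1,
      HasDerivWithinAt (fun t : ℝ => M (p₀ + t • q)) (fderiv ℝ M (p₀ + t • q) q) (Icc 0 1) t := by
    intro q hq t ht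
    have h1 : HasDerivAt (fun t : ℝ => p₀ + t • q) q t := by
      simpa using ((hasDerivAt_id t).smul_const q).const_add p₀
    exact ((hdiff _ (hB1 (hray q hq t ht))).hasFDerivAt.comp_hasDerivAt t h1).hasDerivWithinAt
  have hnq : ∀ q : E, p₀ + q ∈ ball p₀ r → ‖q‖ ≤ r := by
    intro q hq
    rw [mem_ball, dist_eq_norm, add_sub_cancel_left] at hq
    exact hq.le
  have hgen : ∀ q : E, p₀ + q ∈ ball p₀ r → ∀ t ∈ Icc (0 : ℝ) 1, ‖M (p₀ + t • q) q‖ ≤ 1 / 2 := by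
    intro q hq t ht
    refine (le_trans ?_ hrC)
    refine (M (p₀ + t • q)).le_of_opNorm_le_of_le (hM0 _ (hB1 (hray q hq t ht))) (hnq q hq)
  -- The condition on `q` stands inside the existential so that `choose` yields a family defined for
  -- all `q`; the value for rays leaving the ball is irrelevant.
  have hex : ∀ q : E, ∃ v : ℝ → F, p₀ + q ∈ ball p₀ r → v 0 = v₀ ∧
      (∀ t ∈ Icc (0 : ℝ) 1, HasDerivWithinAt v (M (p₀ + t • q) q (v t)) (Icc 0 1) t) ∧
      ∀ t ∈ Icc (0 : ℝ) 1, ‖v t‖ ≤ 2 * ‖v₀‖ := by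
    intro q
    by_cases hq : p₀ + q ∈ ball p₀ r
    · have hc : ContinuousOn (fun t : ℝ => M (p₀ + t • q)) (Icc 0 1) :=
        fun t ht => HasDerivWithinAt.continuousWithinAt (𝕜 := ℝ) (F := E →L[ℝ] F →L[ℝ] F)
          (hline q hq t ht)
      obtain ⟨v, hv⟩ := exists_solution_linear_ode (fun t => M (p₀ + t • q) q)
        (hc.clm_apply continuousOn_const) (hgen q hq) v₀
      exact ⟨v, fun _ => hv⟩
    · exact ⟨0, fun h => absurd h hq⟩
  choose v hv using hex
  set A := (C + C + (C + C) * C) * (2 * ‖v₀‖) with hA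
  have hA0 : 0 ≤ A := by positivity
  have key : ∀ q h : E, p₀ + q ∈ ball p₀ r → p₀ + (q + h) ∈ ball p₀ r →
      ‖v (q + h) 1 - v q 1 - M (p₀ + q) h (v q 1)‖ ≤ 2 * A * ‖h‖ ^ 2 := by
    intro q h hq hqh
    obtain ⟨hv0, hvd, hvb⟩ := hv q hq
    obtain ⟨hu0, hud, -⟩ := hv (q + h) hqh
    -- The expected variation of the ray solution in direction `h` is `t • M (p₀ + t • q) h (v q
    -- t)`; `D` is the error, to be shown quadratic in `h`.
    set D : ℝ → F := fun t => v (q + h) t - v q t - t • M (p₀ + t • q) h (v q t) with hD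
    set D' : ℝ → F := fun t => M (p₀ + t • (q + h)) (q + h) (v (q + h) t) -
      M (p₀ + t • q) q (v q t) - (M (p₀ + t • q) h (v q t) +
        t • (fderiv ℝ M (p₀ + t • q) q h (v q t) +
          M (p₀ + t • q) h (M (p₀ + t • q) q (v q t)))) with hD'
    have hder : ∀ t ∈ Icc (0 : ℝ) 1, HasDerivWithinAt D (D' t) (Icc 0 1) t := by
      intro t ht
      have h1 := ((hline q hq t ht).clm_apply (hasDerivWithinAt_const t _ h)).clm_apply (hvd t ht)
      have h2 := ((hud t ht).sub (hvd t ht)).sub ((hasDerivWithinAt_id t (Icc 0 1)).smul h1)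
      convert! h2 using 1
      simp [hD']
      abel
    have hbd : ∀ t ∈ Icc (0 : ℝ) 1, ‖D' t‖ ≤ 1 / 2 * ‖D t‖ + A * ‖h‖ ^ 2 := by
      intro t ht
      have hx := hB1 (hray q hq t ht)
      have hy := hB1 (hray (q + h) hqh t ht)
      have hyx : p₀ + t • (q + h) - (p₀ + t • q) = t • h := by rw [smul_add]; abel
      have ht1 : ‖t‖ ≤ 1 := by rw [Real.norm_of_nonneg ht.1]; exact ht.2
      have hth : ‖t • h‖ ≤ ‖h‖ := by
        rw [norm_smul]
        exact mul_le_of_le_one_left (norm_nonneg h) ht1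
      refine norm_parallel_defect_le (hflat _ (hB2 (hray q hq t ht)) h q (v q t)) hC.le
        (hM0 _ hx) (hM1 _ hx) ?_ ?_ ((hnq _ hqh).trans hr1) (hgen (q + h) hqh t ht) ht1 (hvb t ht)
      · refine ((convex_ball p₀ r₁).norm_image_sub_le_of_norm_fderiv_le (𝕜 := ℝ) hdiff hM1 hx
          hy).trans ?_
        rw [hyx]
        gcongr
      -- First-order Taylor estimate: along the segment the derivative of `M` differs from its value
      -- at `p₀ + t • q` by at most `C * ‖h‖`.
      · have hseg := (convex_ball p₀ r₁).segment_subset hx hy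
        have hT := (convex_segment (p₀ + t • q)
          (p₀ + t • (q + h))).norm_image_sub_le_of_norm_fderiv_le' (𝕜 := ℝ)
          (C := C * ‖h‖) (φ := fderiv ℝ M (p₀ + t • q))
          (fun z hz => hdiff z (hseg hz)) (fun z hz => ?_) (left_mem_segment ℝ _ _)
          (right_mem_segment ℝ _ _)
        · rw [hyx, map_smul] at hT
          refine hT.trans ?_
          gcongr
        · refine (hM2 z (hseg hz) _ hx).trans ?_
          gcongr
          refine (norm_sub_le_of_mem_segment hz).trans ?_
          rwa [hyx]
    -- Since `D 0 = 0`, Grönwall gives `2 * A * ‖h‖ ^ 2 * (exp (1 / 2) - 1)`, and the last factor is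
    -- less than 1.
    have hg := norm_le_gronwallBound_of_norm_deriv_right_le (f := D) (f' := D')
      (δ := 0) (K := 1 / 2) (ε := A * ‖h‖ ^ 2) (a := 0) (b := 1)
      (fun t ht => (hder t ht).continuousWithinAt)
      (fun t ht => (hder t ⟨ht.1, ht.2.le⟩).mono_of_mem_nhdsWithin (Icc_mem_nhdsGE_of_mem ht))
      (by simp [hD, hv0, hu0])
      (fun t ht => hbd t ⟨ht.1, ht.2.le⟩) 1 (by simp)
    rw [gronwallBound_of_K_ne_0 (by norm_num)] at hg
    simp only [hD, one_smul] at hg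
    refine hg.trans ?_
    have h2 := Real.exp_half_lt_two
    have h3 : 0 ≤ A * ‖h‖ ^ 2 := by positivity
    rw [show (1 / 2 * (1 - 0) : ℝ) = 1 / 2 by norm_num]
    nlinarith
  refine ⟨r, hrpos, hB2, fun p => v (p - p₀) 1, ?_, fun p hp => ?_⟩
  · have h0 : p₀ + (0 : E) ∈ ball p₀ r := by simpa using hrpos
    obtain ⟨hv0, hvd, -⟩ := hv 0 h0
    -- For `q = 0` the ray equation is `v' = 0`.
    have := (convex_Icc (0 : ℝ) 1).norm_image_sub_le_of_norm_hasDerivWithin_le (𝕜 := ℝ) (f := v 0)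
      (C := 0) hvd (fun t _ => by simp) (x := 0) (y := 1) (by simp) (by simp)
    simp only [zero_mul, norm_le_zero_iff, sub_eq_zero] at this
    simp [this, hv0]
  · have hO : (fun y => v (y - p₀) 1 - v (p - p₀) 1 - M p (y - p) (v (p - p₀) 1)) =O[𝓝 p]
        fun y => ‖y - p‖ ^ 2 := by
      refine Asymptotics.IsBigO.of_bound (2 * A) ?_
      filter_upwards [isOpen_ball.mem_nhds hp] with y hy
      have := key (p - p₀) (y - p) (by simpa using hp) (by simpa using hy)
      simpa using this
    have h1 := hO.hasFDerivAt (𝕜 := ℝ) (n := 2) (by norm_num)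
    have h2 : HasFDerivAt (fun y => v (p - p₀) 1 + (M p).flip (v (p - p₀) 1) (y - p))
        ((M p).flip (v (p - p₀) 1)) p :=
      (((M p).flip (v (p - p₀) 1)).hasFDerivAt.comp p
        ((hasFDerivAt_id p).sub_const p)).const_add _
    have h3 := h1.add h2
    rw [zero_add] at h3
    refine h3.congr_of_eventuallyEq (Eventually.of_forall fun y => ?_)
    simp

end Frobenius

/-! ### Affine coordinates of a flat torsion-free connection -/

section AffineChart

variable {E : Type*} [NormedAddCommGroup E] [NormedSpace ℝ E]

/-- The part `(u, J) ↦ (0, J ∘ G)` of the connection below. -/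
noncomputable def affineConnectionLinearPart :
    (E →L[ℝ] E) →L[ℝ] (E × (E →L[ℝ] E)) →L[ℝ] (E × (E →L[ℝ] E)) :=
  (ContinuousLinearMap.compL ℝ _ _ _ (ContinuousLinearMap.inr ℝ E (E →L[ℝ] E))).comp
    (((ContinuousLinearMap.compL ℝ _ _ _).flip (ContinuousLinearMap.snd ℝ E (E →L[ℝ] E))).comp
      (ContinuousLinearMap.compL ℝ E E E).flip)

theorem affineConnectionLinearPart_apply (G : E →L[ℝ] E) (v : E × (E →L[ℝ] E)) :
    affineConnectionLinearPart G v = (0, v.2.comp G) := by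
  simp [affineConnectionLinearPart]

/-- The connection `(u, J) ↦ (J h, J ∘ Γ h)` whose parallel sections are the affine coordinate
systems `u` of the connection with Christoffel symbol `Γ`, paired with their derivatives `J`. -/
noncomputable def affineConnection (Γ : E →L[ℝ] E →L[ℝ] E) :
    E →L[ℝ] (E × (E →L[ℝ] E)) →L[ℝ] (E × (E →L[ℝ] E)) :=
  (ContinuousLinearMap.compL ℝ _ _ _ (ContinuousLinearMap.inl ℝ E (E →L[ℝ] E))).comp
      (((ContinuousLinearMap.compL ℝ _ _ _).flip (ContinuousLinearMap.snd ℝ E (E →L[ℝ] E))).comp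
        (ContinuousLinearMap.apply ℝ E)) + affineConnectionLinearPart.comp Γ

theorem affineConnection_apply (Γ : E →L[ℝ] E →L[ℝ] E) (h : E) (v : E × (E →L[ℝ] E)) :
    affineConnection Γ h v = (v.2 h, v.2.comp (Γ h)) := by
  simp [affineConnection, affineConnectionLinearPart_apply]

theorem contDiff_affineConnection {n : WithTop ℕ∞} :
    ContDiff ℝ n (affineConnection : (E →L[ℝ] E →L[ℝ] E) → _) := by
  unfold affineConnection
  fun_prop

theorem fderiv_affineConnection_comp_apply {Γ : E → E →L[ℝ] E →L[ℝ] E} {p : E}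
    (hΓ : DifferentiableAt ℝ Γ p) (h k : E) (v : E × (E →L[ℝ] E)) :
    fderiv ℝ (fun p => affineConnection (Γ p)) p h k v = (0, v.2.comp (fderiv ℝ Γ p h k)) := by
  -- `affineConnection` is affine in `Γ` with constant term `affineConnection 0`, so only the linear
  -- part is differentiated.
  have h1 := (((ContinuousLinearMap.compL ℝ E _ _
    (affineConnectionLinearPart (E := E))).hasFDerivAt (x := Γ p)).comp p
      hΓ.hasFDerivAt).const_add (affineConnection (0 : E →L[ℝ] E →L[ℝ] E))
  have h2 : HasFDerivAt (fun p => affineConnection (Γ p)) _ p :=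
    h1.congr_of_eventuallyEq (Eventually.of_forall fun q => by simp [affineConnection])
  rw [h2.fderiv]
  simp [affineConnectionLinearPart_apply]

variable [CompleteSpace E]

/-- A flat torsion-free connection has an affine coordinate system around every point. -/
theorem exists_affine_coordinates (Γ : E → E →L[ℝ] E →L[ℝ] E) {Ω : Set E}
    (hΩ : IsOpen Ω) (hΓ : ContDiffOn ℝ ∞ Γ Ω) (hsymm : ∀ p ∈ Ω, ∀ h k, Γ p h k = Γ p k h)
    (hflat : ∀ p ∈ Ω, ∀ h k l, fderiv ℝ Γ p h k l + Γ p h (Γ p k l) =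
      fderiv ℝ Γ p k h l + Γ p k (Γ p h l))
    {p₀ : E} (hp₀ : p₀ ∈ Ω) :
    ∃ r > 0, ball p₀ r ⊆ Ω ∧ ∃ (u : E → E) (J : E → E →L[ℝ] E), J p₀ = .id ℝ E ∧
      ContDiffOn ℝ ∞ u (ball p₀ r) ∧ ∀ p ∈ ball p₀ r, HasFDerivAt u (J p) p ∧
        HasFDerivAt J ((ContinuousLinearMap.compL ℝ E E E (J p)).comp (Γ p)) p := by
  have hM : ContDiffOn ℝ ∞ (fun p => affineConnection (Γ p)) Ω :=
    contDiff_affineConnection.comp_contDiffOn hΓ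
  obtain ⟨r, hr, hsub, w, hw0, hw⟩ := exists_parallel_section (fun p => affineConnection (Γ p)) hΩ
    (contDiffOn_infty.1 hM 2) (fun p hp h k v => by
      have hd : DifferentiableAt ℝ Γ p :=
        (hΓ.contDiffAt (hΩ.mem_nhds hp)).differentiableAt (by simp)
      rw [fderiv_affineConnection_comp_apply hd, fderiv_affineConnection_comp_apply hd]
      simp only [affineConnection_apply]
      -- The integrability condition splits: its first component is the symmetry of `Γ`, its second
      -- the flatness of `Γ`.
      refine Prod.ext ?_ ?_
      · simp [hsymm p hp h k]
      · ext l
        simpa using congrArg v.2 (hflat p hp h k l)) hp₀ ((0 : E), ContinuousLinearMap.id ℝ E)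
  have hws : ContDiffOn ℝ ∞ w (ball p₀ r) :=
    contDiffOn_of_hasFDerivAt_flip isOpen_ball (hM.mono hsub) hw
  refine ⟨r, hr, hsub, fun p => (w p).1, fun p => (w p).2, by simp [hw0], hws.fst,
    fun p hp => ⟨?_, ?_⟩⟩
  · convert! (hw p hp).fst using 1
    ext h
    simp [affineConnection_apply]
  · convert! (hw p hp).snd using 1
    ext h
    simp [affineConnection_apply]

/-- Around every point, a flat torsion-free connection has a chart in which it is trivial. -/
theorem exists_affine_chart (Γ : E → E →L[ℝ] E →L[ℝ] E) {Ω : Set E}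
    (hΩ : IsOpen Ω) (hΓ : ContDiffOn ℝ ∞ Γ Ω) (hsymm : ∀ p ∈ Ω, ∀ h k, Γ p h k = Γ p k h)
    (hflat : ∀ p ∈ Ω, ∀ h k l, fderiv ℝ Γ p h k l + Γ p h (Γ p k l) =
      fderiv ℝ Γ p k h l + Γ p k (Γ p h l))
    {p₀ : E} (hp₀ : p₀ ∈ Ω) :
    ∃ (φ : OpenPartialHomeomorph E E) (J : E → E →L[ℝ] E), p₀ ∈ φ.source ∧ φ.source ⊆ Ω ∧
      ContDiffOn ℝ ∞ φ φ.source ∧ ContDiffOn ℝ ∞ φ.symm φ.target ∧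
      ∀ p ∈ φ.source, Function.Injective (J p) ∧ HasFDerivAt φ (J p) p ∧
        HasFDerivAt J ((ContinuousLinearMap.compL ℝ E E E (J p)).comp (Γ p)) p := by
  obtain ⟨r, hr, hsub, u, J, hJ0, hu, hJ⟩ := exists_affine_coordinates Γ hΩ hΓ hsymm hflat hp₀
  have hp₀r : p₀ ∈ ball p₀ r := mem_ball_self hr
  have hu₀ : ContDiffAt ℝ ∞ u p₀ := hu.contDiffAt (isOpen_ball.mem_nhds hp₀r)
  have hd₀ : HasFDerivAt u ((ContinuousLinearEquiv.refl ℝ E : E ≃L[ℝ] E) : E →L[ℝ] E) p₀ := by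
    have := (hJ p₀ hp₀r).1
    rwa [hJ0] at this
  have hJc : ContinuousOn J (ball p₀ r) :=
    fun p hp => HasFDerivAt.continuousAt (hJ p hp).2 |>.continuousWithinAt
  -- The inverse function theorem is applied at `p₀` only. Restricting to the open set where `J` is
  -- an isomorphism makes the inverse smooth, and `J` injective, at every point.
  have hso : IsOpen (ball p₀ r ∩ J ⁻¹' range ((↑) : (E ≃L[ℝ] E) → E →L[ℝ] E)) :=
    hJc.isOpen_inter_preimage isOpen_ball ContinuousLinearEquiv.isOpen
  set s := ball p₀ r ∩ J ⁻¹' range ((↑) : (E ≃L[ℝ] E) → E →L[ℝ] E) with hs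
  set φ := (hu₀.toOpenPartialHomeomorph u hd₀ (by simp)).restrOpen s hso with hφ
  have hcoe : (φ : E → E) = u := rfl
  have hsrc : φ.source ⊆ s := fun p hp => hp.2
  refine ⟨φ, J, ⟨hu₀.mem_toOpenPartialHomeomorph_source hd₀ (by simp), hp₀r,
    ContinuousLinearEquiv.refl ℝ E, hJ0.symm⟩, fun p hp => hsub (hsrc hp).1,
    hu.mono fun p hp => (hsrc hp).1, fun q hq => ?_, fun p hp => ⟨?_, hJ p (hsrc hp).1⟩⟩
  · have hp := hsrc (φ.map_target hq)
    obtain ⟨e, he⟩ := hp.2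
    refine (φ.contDiffAt_symm (f₀' := e) hq ?_ ?_).contDiffWithinAt
    · rw [he]
      exact (hJ _ hp.1).1
    · exact hu.contDiffAt (isOpen_ball.mem_nhds hp.1)
  · obtain ⟨e, he⟩ := (hsrc hp).2
    rw [← he]
    exact e.injective

end AffineChart

/-! ### Curves: second-order equations and their differentiated third-order equations -/

section Curves

variable {E : Type*} [NormedAddCommGroup E] [NormedSpace ℝ E]

/-- A solution of a linear equation `v' = B v` that vanishes at one point vanishes to the right. -/
theorem linear_ode_eq_zero_right {B : ℝ → E →L[ℝ] E} {v : ℝ → E} {a b : ℝ}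
    (hB : ContinuousOn B (Icc a b)) (hv : ∀ t ∈ Icc a b, HasDerivAt v (B t (v t)) t)
    (ha : v a = 0) : ∀ t ∈ Icc a b, v t = 0 := by
  obtain ⟨K, hK⟩ := isCompact_Icc.exists_bound_of_continuousOn hB
  exact eq_zero_of_abs_deriv_le_mul_abs_self_of_eq_zero_right (K := K)
    (fun t ht => (hv t ht).continuousAt.continuousWithinAt)
    (fun t ht => (hv t ⟨ht.1, ht.2.le⟩).hasDerivWithinAt) ha
    (fun t ht => (B t).le_of_opNorm_le (hK t ⟨ht.1, ht.2.le⟩) (v t))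

/-- A solution of a linear equation `v' = B v` on an interval that vanishes at one point is zero. -/
theorem linear_ode_eq_zero {B : ℝ → E →L[ℝ] E} {v : ℝ → E} {I : Set ℝ} (hI : IsPreconnected I)
    (hB : ContinuousOn B I) (hv : ∀ t ∈ I, HasDerivAt v (B t (v t)) t) {s₀ : ℝ} (hs₀ : s₀ ∈ I)
    (h₀ : v s₀ = 0) {s : ℝ} (hs : s ∈ I) : v s = 0 := by
  have hc := hI.ordConnected
  rcases le_total s₀ s with h | h
  · have hsub := hc.out hs₀ hs
    exact linear_ode_eq_zero_right (hB.mono hsub) (fun t ht => hv t (hsub ht)) h₀ s ⟨h, le_rfl⟩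
  · have hsub : ∀ t ∈ Icc (-s₀) (-s), -t ∈ I := fun t ht =>
      hc.out hs hs₀ ⟨by linarith [ht.2], by linarith [ht.1]⟩
    -- To the left of `s₀`, time is reversed.
    have := linear_ode_eq_zero_right (B := fun t => -B (-t)) (v := fun t => v (-t))
      (a := -s₀) (b := -s) ((hB.comp continuous_neg.continuousOn hsub).neg)
      (fun t ht => by
        have := (hv (-t) (hsub t ht)).scomp t (hasDerivAt_neg t)
        simpa [Function.comp_def] using this) (by simpa) (-s) ⟨by linarith, le_rfl⟩
    simpa using this

theorem hasDerivAt_iteratedDeriv {γ : ℝ → E} {I : Set ℝ} {n : ℕ} (hI : IsOpen I)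
    (hγ : ContDiffOn ℝ (n + 1 : ℕ) γ I) {s : ℝ} (hs : s ∈ I) :
    HasDerivAt (iteratedDeriv n γ) (iteratedDeriv (n + 1) γ s) s := by
  induction n generalizing γ with
  | zero =>
    simpa using ((hγ.contDiffAt (hI.mem_nhds hs)).differentiableAt (by simp)).hasDerivAt
  | succ n ih =>
    rw [iteratedDeriv_succ', iteratedDeriv_succ']
    have h := hγ
    rw [Nat.cast_succ, contDiffOn_succ_iff_deriv_of_isOpen hI] at h
    exact ih h.2.2

/-- The second derivative of a curve in an affine chart is its covariant acceleration. -/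
theorem iteratedDeriv_two_comp_affine_chart {Γ : E → E →L[ℝ] E →L[ℝ] E} {u : E → E}
    {J : E → E →L[ℝ] E} {N : Set E} (hJ : ∀ p ∈ N, HasFDerivAt u (J p) p ∧
      HasFDerivAt J ((ContinuousLinearMap.compL ℝ E E E (J p)).comp (Γ p)) p)
    {γ : ℝ → E} {I : Set ℝ} (hI : IsOpen I) (hγ : ContDiffOn ℝ 2 γ I) (hN : MapsTo γ I N)
    {s : ℝ} (hs : s ∈ I) : iteratedDeriv 2 (u ∘ γ) s =
      J (γ s) (iteratedDeriv 2 γ s + Γ (γ s) (deriv γ s) (deriv γ s)) := by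
  have h1 : ∀ t ∈ I, HasDerivAt γ (deriv γ t) t := fun t ht =>
    ((hγ.contDiffAt (hI.mem_nhds ht)).differentiableAt (by simp)).hasDerivAt
  have h2 : HasDerivAt (deriv γ) (iteratedDeriv 2 γ s) s := by
    simpa using hasDerivAt_iteratedDeriv (n := 1) hI (by exact_mod_cast hγ) hs
  have h3 : deriv (u ∘ γ) =ᶠ[𝓝 s] fun t => J (γ t) (deriv γ t) := by
    filter_upwards [hI.mem_nhds hs] with t ht
    exact ((hJ _ (hN ht)).1.comp_hasDerivAt t (h1 t ht)).deriv
  have h4 : HasDerivAt (fun t => J (γ t) (deriv γ t)) _ s :=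
    ((hJ _ (hN hs)).2.comp_hasDerivAt s (h1 s hs)).clm_apply h2
  rw [iteratedDeriv_succ, iteratedDeriv_one, h3.deriv_eq, h4.deriv]
  simp [add_comm]

/-- If `γ` has the third derivative prescribed by differentiating `z'' = F (z, z')` and eliminating
`z''`, and satisfies `z'' = F (z, z')` at one instant, then it satisfies it on its interval. -/
theorem second_order_of_third_order {F : E × E → E} {N : Set E} (hNo : IsOpen N)
    (hF : ContDiffOn ℝ 1 F (N ×ˢ univ)) {γ : ℝ → E} {I : Set ℝ} (hI : IsOpen I)
    (hIc : IsPreconnected I) (hγ : ContDiffOn ℝ 3 γ I) (hN : MapsTo γ I N)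
    (h3 : ∀ s ∈ I, iteratedDeriv 3 γ s =
      fderiv ℝ F (γ s, deriv γ s) (deriv γ s, F (γ s, deriv γ s)))
    {s₀ : ℝ} (hs₀ : s₀ ∈ I) (h₀ : iteratedDeriv 2 γ s₀ = F (γ s₀, deriv γ s₀))
    {s : ℝ} (hs : s ∈ I) : iteratedDeriv 2 γ s = F (γ s, deriv γ s) := by
  have ho : IsOpen (N ×ˢ (univ : Set E)) := hNo.prod isOpen_univ
  have h1 : ∀ t ∈ I, HasDerivAt γ (deriv γ t) t := fun t ht =>
    ((hγ.contDiffAt (hI.mem_nhds ht)).differentiableAt (by simp)).hasDerivAt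
  have h2 : ∀ t ∈ I, HasDerivAt (deriv γ) (iteratedDeriv 2 γ t) t := fun t ht => by
    simpa using hasDerivAt_iteratedDeriv (n := 1) hI
      (hγ.of_le (by norm_num)) ht
  have h2' : ∀ t ∈ I, HasDerivAt (iteratedDeriv 2 γ) (iteratedDeriv 3 γ t) t := fun t ht =>
    hasDerivAt_iteratedDeriv (n := 2) hI (by exact_mod_cast hγ) ht
  have hmem : ∀ t ∈ I, (γ t, deriv γ t) ∈ N ×ˢ (univ : Set E) := fun t ht => ⟨hN ht, trivial⟩
  have hFd : ∀ t ∈ I, HasDerivAt (fun t => F (γ t, deriv γ t))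
      (fderiv ℝ F (γ t, deriv γ t) (deriv γ t, iteratedDeriv 2 γ t)) t := fun t ht =>
    ((hF.contDiffAt (ho.mem_nhds (hmem t ht))).differentiableAt
      (by simp)).hasFDerivAt.comp_hasDerivAt t ((h1 t ht).prodMk (h2 t ht))
  have hc : ContinuousOn (fun t => fderiv ℝ F (γ t, deriv γ t)) I :=
    (hF.continuousOn_fderiv_of_isOpen ho le_rfl).comp
      (fun t ht => ((h1 t ht).continuousAt.prodMk (h2 t ht).continuousAt).continuousWithinAt) hmem
  -- The derivatives of `γ''` and of `F (γ, γ')` are the same linear map applied to `(γ', F)` and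
  -- `(γ', γ'')`. These differ only in the velocity slot, so the deviation `v` obeys `v' = -(∂F/∂z')
  -- v`.
  have key := linear_ode_eq_zero (B := fun t =>
      -(fderiv ℝ F (γ t, deriv γ t)).comp (ContinuousLinearMap.inr ℝ E E))
    (v := fun t => iteratedDeriv 2 γ t - F (γ t, deriv γ t)) hIc
    ((hc.clm_comp continuousOn_const).neg) (fun t ht => by
      convert! (h2' t ht).sub (hFd t ht) using 1
      rw [h3 t ht, ← map_sub]
      simp [← map_neg]) hs₀ (sub_eq_zero.2 h₀) hs
  exact sub_eq_zero.1 key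

/-- A solution of `z'' = F (z, z')` has the third derivative obtained by differentiating the
equation and eliminating `z''`. -/
theorem third_order_of_second_order {F : E × E → E} {N : Set E} (hNo : IsOpen N)
    (hF : ContDiffOn ℝ 1 F (N ×ˢ univ)) {γ : ℝ → E} {I : Set ℝ} (hI : IsOpen I)
    (hγ : ContDiffOn ℝ 2 γ I) (hN : MapsTo γ I N)
    (h2 : ∀ s ∈ I, iteratedDeriv 2 γ s = F (γ s, deriv γ s)) {s : ℝ} (hs : s ∈ I) :
    iteratedDeriv 3 γ s = fderiv ℝ F (γ s, deriv γ s) (deriv γ s, F (γ s, deriv γ s)) := by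
  have ho : IsOpen (N ×ˢ (univ : Set E)) := hNo.prod isOpen_univ
  have h1 : HasDerivAt γ (deriv γ s) s :=
    ((hγ.contDiffAt (hI.mem_nhds hs)).differentiableAt (by simp)).hasDerivAt
  have h2' : HasDerivAt (deriv γ) (iteratedDeriv 2 γ s) s := by
    simpa using hasDerivAt_iteratedDeriv (n := 1) hI (by exact_mod_cast hγ) hs
  -- `γ` is only assumed `C²`; its third derivative is obtained from the equation, valid near `s`.
  have heq : iteratedDeriv 2 γ =ᶠ[𝓝 s] fun t => F (γ t, deriv γ t) := by
    filter_upwards [hI.mem_nhds hs] with t ht using h2 t ht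
  rw [iteratedDeriv_succ, heq.deriv_eq, ← h2 s hs]
  exact (((hF.contDiffAt (ho.mem_nhds (⟨hN hs, trivial⟩ :
    (γ s, deriv γ s) ∈ N ×ˢ (univ : Set E)))).differentiableAt
      (by simp)).hasFDerivAt.comp_hasDerivAt s (h1.prodMk h2')).deriv

end Curves

/-! ### Smoothness and flatness of the Cramer coefficients -/

namespace ThirdOrder

theorem contDiffOn_dx {f : Plane → ℝ} {Ω : Set Plane} (hΩ : IsOpen Ω)
    (hf : ContDiffOn ℝ ∞ f Ω) : ContDiffOn ℝ ∞ (dx f) Ω :=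
  (hf.fderiv_of_isOpen hΩ (by simp)).clm_apply contDiffOn_const

theorem contDiffOn_dy {f : Plane → ℝ} {Ω : Set Plane} (hΩ : IsOpen Ω)
    (hf : ContDiffOn ℝ ∞ f Ω) : ContDiffOn ℝ ∞ (dy f) Ω :=
  (hf.fderiv_of_isOpen hΩ (by simp)).clm_apply contDiffOn_const

theorem fderiv_apply_eq_dx_dy (f : Plane → ℝ) (p h : Plane) :
    fderiv ℝ f p h = h.1 * dx f p + h.2 * dy f p := by
  have : h = h.1 • ((1, 0) : Plane) + h.2 • ((0, 1) : Plane) := by ext <;> simp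
  conv_lhs => rw [this]
  rw [map_add, map_smul, map_smul]
  rfl

namespace CubicSystem

set_option maxHeartbeats 1000000 in
theorem cramerCoeffs_smoothOn (A : CubicSystem) {Ω : Set Plane} (hΩ : IsOpen Ω)
    (hA : A.SmoothOn Ω) (hΔ : ∀ p ∈ Ω, A.delta p ≠ 0) : A.cramerCoeffs.SmoothOn Ω := by
  obtain ⟨hP, hQ, hR, hS, hT, hU, hV, hW⟩ := hA
  -- `h1` to `h6` concern the six combinations that are the arguments `r₁, …, r₆` of the numerators.
  have h1 := (contDiffOn_const (c := (3 : ℝ))).mul (contDiffOn_dy hΩ hP) |>.sub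
    (contDiffOn_dx hΩ hQ)
  have h2 := (contDiffOn_dy hΩ hQ).sub (contDiffOn_dx hΩ hR)
  have h3 := (contDiffOn_dy hΩ hR).sub
    ((contDiffOn_const (c := (3 : ℝ))).mul (contDiffOn_dx hΩ hS))
  have h4 := (contDiffOn_const (c := (3 : ℝ))).mul (contDiffOn_dy hΩ hT) |>.sub
    (contDiffOn_dx hΩ hU)
  have h5 := (contDiffOn_dy hΩ hU).sub (contDiffOn_dx hΩ hV)
  have h6 := (contDiffOn_dy hΩ hV).sub
    ((contDiffOn_const (c := (3 : ℝ))).mul (contDiffOn_dx hΩ hW))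
  have hD : ContDiffOn ℝ ∞ A.delta Ω := by
    unfold delta cramerDelta
    fun_prop
  have hDi : ContDiffOn ℝ ∞ (fun p => 1 / A.delta p) Ω := contDiffOn_const.div hD hΔ
  refine ⟨hDi.mul ?_, hDi.mul ?_, hDi.mul ?_, hDi.mul ?_, hDi.mul ?_, hDi.mul ?_⟩
  · unfold evalNum cramerNumA
    fun_prop
  · unfold evalNum cramerNumB
    fun_prop
  · unfold evalNum cramerNumC
    fun_prop
  · unfold evalNum cramerNumD
    fun_prop
  · unfold evalNum cramerNumE
    fun_prop
  · unfold evalNum cramerNumF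
    fun_prop

end CubicSystem

namespace QuadSystem

theorem riemann_eq_zero_of_lt (G : QuadSystem) (p : Plane)
    (h : ∀ i j, G.riemann i j 0 1 p = 0) (i j k l : Fin 2) : G.riemann i j k l p = 0 := by
  have hswap : ∀ k l, G.riemann i j k l p = - G.riemann i j l k p := fun k l => by
    simp only [riemann, Fin.sum_univ_two]
    ring
  have h01 := h i j
  have h10 := hswap 1 0
  have h00 := hswap 0 0
  have h11 := hswap 1 1
  fin_cases k <;> fin_cases l <;> simp only [Fin.zero_eta, Fin.mk_one, Fin.isValue] <;> linarith

theorem dx_neg (f : Plane → ℝ) (p : Plane) : dx (-f) p = -dx f p := by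
  simp [dx, fderiv_neg]

theorem dy_neg (f : Plane → ℝ) (p : Plane) : dy (-f) p = -dy f p := by
  simp [dy, fderiv_neg]

end QuadSystem

/-- The two derivatives subtracted in a component `Rⁱⱼ₀₁` carry the same term `-Q/3`, `-R/3`, `-U/3`
or `-V/3`; once it cancels, the quadratic rest is the negative of the `ΓΓ` terms. -/
theorem CubicSystem.SatisfiesRelations.isFlatOn {A : CubicSystem} {G : QuadSystem} {Ω : Set Plane}
    (h : A.SatisfiesRelations G Ω) : G.IsFlatOn Ω := by
  intro p hp
  obtain ⟨ax, ay, bx, b_y, cx, cy, d_x, d_y, ex, ey, fx, fy⟩ := h p hp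
  refine G.riemann_eq_zero_of_lt p fun i j => ?_
  fin_cases i <;> fin_cases j <;>
  · simp [QuadSystem.riemann, QuadSystem.christoffel, partialDeriv, QuadSystem.dx_neg,
      QuadSystem.dy_neg, Fin.sum_univ_two, ax, ay, bx, b_y, cx, cy, d_x, d_y, ex, ey, fx, fy]
    ring

end ThirdOrder

/-! ### The connection of the second-order system and the linearization -/

namespace ThirdOrder

/-- The bilinear map `(h, k) ↦ l h * m k • e` of the plane. -/
noncomputable def bilin (l m : Plane →L[ℝ] ℝ) (e : Plane) : Plane →L[ℝ] Plane →L[ℝ] Plane :=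
  l.smulRight (m.smulRight e)

theorem bilin_apply (l m : Plane →L[ℝ] ℝ) (e h k : Plane) :
    bilin l m e h k = (l h * m k) • e := by
  simp [bilin, mul_smul]

namespace QuadSystem

/-- The Christoffel symbol as a function with values in the bilinear maps of the plane. -/
noncomputable def connection (G : QuadSystem) (p : Plane) : Plane →L[ℝ] Plane →L[ℝ] Plane :=
  G.a p • bilin (.fst ℝ ℝ ℝ) (.fst ℝ ℝ ℝ) (-1, 0) +
    G.b p • (bilin (.fst ℝ ℝ ℝ) (.snd ℝ ℝ ℝ) (-1, 0) +
      bilin (.snd ℝ ℝ ℝ) (.fst ℝ ℝ ℝ) (-1, 0)) +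
    G.c p • bilin (.snd ℝ ℝ ℝ) (.snd ℝ ℝ ℝ) (-1, 0) +
    G.d p • bilin (.fst ℝ ℝ ℝ) (.fst ℝ ℝ ℝ) (0, -1) +
    G.e p • (bilin (.fst ℝ ℝ ℝ) (.snd ℝ ℝ ℝ) (0, -1) +
      bilin (.snd ℝ ℝ ℝ) (.fst ℝ ℝ ℝ) (0, -1)) +
    G.f p • bilin (.snd ℝ ℝ ℝ) (.snd ℝ ℝ ℝ) (0, -1)

theorem connection_apply (G : QuadSystem) (p h k : Plane) : G.connection p h k =
    (-(G.a p * (h.1 * k.1) + G.b p * (h.1 * k.2 + h.2 * k.1) + G.c p * (h.2 * k.2)),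
      -(G.d p * (h.1 * k.1) + G.e p * (h.1 * k.2 + h.2 * k.1) + G.f p * (h.2 * k.2))) := by
  ext <;> simp [connection, bilin_apply] <;> ring

theorem connection_symm (G : QuadSystem) (p h k : Plane) :
    G.connection p h k = G.connection p k h := by
  simp only [connection_apply]
  ext <;> ring

theorem accel_eq_neg_connection (G : QuadSystem) (p q : Plane) :
    G.accel p q = -G.connection p q q := by
  rw [connection_apply]
  ext <;> simp [accel] <;> ring

theorem SmoothOn.connection {G : QuadSystem} {Ω : Set Plane} (hG : G.SmoothOn Ω) :
    ContDiffOn ℝ ∞ G.connection Ω := by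
  obtain ⟨ha, hb, hc, hd, he, hf⟩ := hG
  exact (((((ha.smul contDiffOn_const).add (hb.smul contDiffOn_const)).add
    (hc.smul contDiffOn_const)).add (hd.smul contDiffOn_const)).add
    (he.smul contDiffOn_const)).add (hf.smul contDiffOn_const)

theorem SmoothOn.fderiv_connection_apply {G : QuadSystem} {Ω : Set Plane} (hΩ : IsOpen Ω)
    (hG : G.SmoothOn Ω) {p : Plane} (hp : p ∈ Ω) (h k l : Plane) :
    fderiv ℝ G.connection p h k l =
    (-((h.1 * dx G.a p + h.2 * dy G.a p) * (k.1 * l.1) +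
        (h.1 * dx G.b p + h.2 * dy G.b p) * (k.1 * l.2 + k.2 * l.1) +
        (h.1 * dx G.c p + h.2 * dy G.c p) * (k.2 * l.2)),
      -((h.1 * dx G.d p + h.2 * dy G.d p) * (k.1 * l.1) +
        (h.1 * dx G.e p + h.2 * dy G.e p) * (k.1 * l.2 + k.2 * l.1) +
        (h.1 * dx G.f p + h.2 * dy G.f p) * (k.2 * l.2))) := by
  obtain ⟨ha, hb, hc, hd, he, hf⟩ := hG
  have key : ∀ {g : Plane → ℝ}, ContDiffOn ℝ ∞ g Ω → HasFDerivAt g (fderiv ℝ g p) p := fun hg =>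
    ((hg.contDiffAt (hΩ.mem_nhds hp)).differentiableAt (by simp)).hasFDerivAt
  have hD : HasFDerivAt G.connection _ p :=
    ((((((key ha).smul_const _).add ((key hb).smul_const _)).add ((key hc).smul_const _)).add
      ((key hd).smul_const _)).add ((key he).smul_const _)).add ((key hf).smul_const _)
  rw [hD.fderiv]
  simp only [← fderiv_apply_eq_dx_dy]
  ext <;> simp [bilin_apply] <;> ring

/-- The difference of the two sides is alternating in `h, k`, hence in the plane a multiple of `h.1
* k.2 - h.2 * k.1`; the factor is made of the components `Rⁱⱼ₀₁`. -/
theorem IsFlatOn.fderiv_connection {G : QuadSystem} {Ω : Set Plane} (hΩ : IsOpen Ω)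
    (hG : G.SmoothOn Ω) (hflat : G.IsFlatOn Ω) {p : Plane} (hp : p ∈ Ω) (h k l : Plane) :
    fderiv ℝ G.connection p h k l + G.connection p h (G.connection p k l) =
      fderiv ℝ G.connection p k h l + G.connection p k (G.connection p h l) := by
  rw [hG.fderiv_connection_apply hΩ hp, hG.fderiv_connection_apply hΩ hp]
  simp only [connection_apply]
  have h00 := hflat p hp 0 0 0 1
  have h01 := hflat p hp 0 1 0 1
  have h10 := hflat p hp 1 0 0 1
  have h11 := hflat p hp 1 1 0 1
  simp [riemann, christoffel, partialDeriv, dx_neg, dy_neg, Fin.sum_univ_two] at h00 h01 h10 h11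
  ext
  · simp only [Prod.fst_add]
    linear_combination (h.1 * k.2 - h.2 * k.1) * (l.1 * h00 + l.2 * h01)
  · simp only [Prod.snd_add]
    linear_combination (h.1 * k.2 - h.2 * k.1) * (l.1 * h10 + l.2 * h11)

theorem SmoothOn.accel {G : QuadSystem} {Ω : Set Plane} (hG : G.SmoothOn Ω) :
    ContDiffOn ℝ ∞ (fun z : Plane × Plane => G.accel z.1 z.2) (Ω ×ˢ univ) := by
  simp only [accel_eq_neg_connection]
  exact (((hG.connection.comp contDiffOn_fst fun z hz => hz.1).clm_apply
    contDiffOn_snd).clm_apply contDiffOn_snd).neg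

/-- Product rule for `-Γ(z, z', z')`; by symmetry of `Γ` the two velocity slots contribute equally,
whence the factor 2. -/
theorem SmoothOn.jerk_eq {G : QuadSystem} {Ω : Set Plane} (hΩ : IsOpen Ω) (hG : G.SmoothOn Ω)
    {p : Plane} (hp : p ∈ Ω) (q : Plane) : G.jerk p q =
      -(fderiv ℝ G.connection p q q q + (2 : ℝ) • G.connection p q (G.accel p q)) := by
  have hc : HasFDerivAt G.connection (fderiv ℝ G.connection p) ((p, q) : Plane × Plane).1 :=
    ((hG.connection.contDiffAt (hΩ.mem_nhds hp)).differentiableAt (by simp)).hasFDerivAt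
  have hD : HasFDerivAt (fun z : Plane × Plane => -G.connection z.1 z.2 z.2) _ (p, q) :=
    (((hc.comp (p, q) hasFDerivAt_fst).clm_apply hasFDerivAt_snd).clm_apply hasFDerivAt_snd).neg
  have hF : (fun z : Plane × Plane => G.accel z.1 z.2) =
      fun z => -G.connection z.1 z.2 z.2 := by
    funext z
    exact G.accel_eq_neg_connection z.1 z.2
  rw [jerk, hF, hD.fderiv]
  simp only [neg_apply, add_apply, ContinuousLinearMap.comp_apply,
    ContinuousLinearMap.flip_apply, ContinuousLinearMap.coe_fst', ContinuousLinearMap.coe_snd',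
    Function.comp_apply, G.connection_symm p (G.accel p q) q]
  rw [two_smul]
  abel

/-- A chart in which the connection of `G` is trivial linearizes `G`. -/
theorem linearizesQuad_of_chart {G : QuadSystem} {φ : OpenPartialHomeomorph Plane Plane}
    {J : Plane → Plane →L[ℝ] Plane} (hJ : ∀ p ∈ φ.source, Function.Injective (J p) ∧
      HasFDerivAt φ (J p) p ∧
        HasFDerivAt J ((ContinuousLinearMap.compL ℝ _ _ _ (J p)).comp (G.connection p)) p) :
    LinearizesQuad φ G := by
  intro I γ hI hγ hN
  rw [IsSolutionOn, and_iff_right hγ]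
  refine forall₂_congr fun s hs => ?_
  rw [iteratedDeriv_two_comp_affine_chart (fun p hp => (hJ p hp).2) hI hγ hN hs,
    map_eq_zero_iff _ (hJ _ (hN hs)).1, accel_eq_neg_connection, eq_neg_iff_add_eq_zero]

end QuadSystem

/-- Compare coefficients of the cubic forms in `q`: for `q.1 ^ 2 * q.2` the derivatives enter as
`a_y + 2 b_x`, which gives `-Q`, and the quadratic terms cancel against `2 Γ(q, G(p, q))`. -/
theorem CubicSystem.SatisfiesRelations.arisesFrom {A : CubicSystem} {G : QuadSystem}
    {Ω : Set Plane} (hΩ : IsOpen Ω) (hG : G.SmoothOn Ω) (h : A.SatisfiesRelations G Ω) :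
    A.ArisesFrom G Ω := by
  intro p hp q
  obtain ⟨ax, ay, bx, b_y, cx, cy, d_x, d_y, ex, ey, fx, fy⟩ := h p hp
  rw [hG.jerk_eq hΩ hp, hG.fderiv_connection_apply hΩ hp, QuadSystem.connection_apply, ax, ay, bx,
    b_y, cx, cy, d_x, d_y, ex, ey, fx, fy]
  simp only [CubicSystem.thirdDeriv, QuadSystem.accel, Prod.smul_mk, Prod.mk_add_mk, Prod.neg_mk,
    smul_eq_mul]
  ext
  · ring
  · ring

/-- A point transformation that linearizes `G` linearizes, subject to `G`, every third-order system
that arises from `G`. -/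
theorem linearizesCubic_of_linearizesQuad {A : CubicSystem} {G : QuadSystem} {Ω : Set Plane}
    (hΩ : IsOpen Ω) (hG : G.SmoothOn Ω) (hA : A.ArisesFrom G Ω)
    {φ : OpenPartialHomeomorph Plane Plane} (hφ : φ.source ⊆ Ω) (hlin : LinearizesQuad φ G) :
    LinearizesCubic φ A G := by
  intro I γ hI hIc hγ hN s₀ hs₀
  have hNΩ : MapsTo γ I Ω := fun s hs => hφ (hN hs)
  have hγ2 : ContDiffOn ℝ 2 γ I := hγ.of_le (by norm_num)
  have hF : ContDiffOn ℝ 1 (fun z : Plane × Plane => G.accel z.1 z.2) (Ω ×ˢ univ) :=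
    contDiffOn_infty.1 hG.accel 1
  -- From here the chart plays no role: it remains to compare solutions of `A` and of `G`.
  rw [← hlin I γ hI hγ2 hN]
  constructor
  · rintro ⟨⟨-, h3⟩, h₀⟩
    refine ⟨hγ2, fun s hs => second_order_of_third_order
      (F := fun z : Plane × Plane => G.accel z.1 z.2) hΩ hF hI hIc hγ hNΩ (fun t ht => ?_)
      hs₀ h₀ hs⟩
    rw [h3 t ht, hA _ (hNΩ ht)]
    rfl
  · rintro ⟨-, h2⟩
    refine ⟨⟨hγ, fun s hs => ?_⟩, h2 s₀ hs₀⟩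
    rw [hA _ (hNΩ hs)]
    exact third_order_of_second_order (F := fun z : Plane × Plane => G.accel z.1 z.2) hΩ hF hI hγ2
      hNΩ h2 hs

end ThirdOrder

theorem mainTheorem1 (Ω : Set ThirdOrder.Plane) (hΩ : IsOpen Ω)
    (A : ThirdOrder.CubicSystem) (hA : A.SmoothOn Ω)
    (hΔ : ∀ p ∈ Ω, A.delta p ≠ 0)
    (hrel : A.SatisfiesRelations A.cramerCoeffs Ω) :
    A.IsLinearizableSubjectTo A.cramerCoeffs Ω := by
  have hG := A.cramerCoeffs_smoothOn hΩ hA hΔ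
  have hflat := hrel.isFlatOn
  have harises := hrel.arisesFrom hΩ hG
  refine ⟨hG, hflat, harises, fun p₀ hp₀ => ?_⟩
  obtain ⟨φ, J, hp, hsub, hφ, hφ', hJ⟩ := exists_affine_chart A.cramerCoeffs.connection hΩ
    hG.connection (fun p _ h k => A.cramerCoeffs.connection_symm p h k)
    (fun p hp h k l => hflat.fderiv_connection hΩ hG hp h k l) hp₀
  have hlin := ThirdOrder.QuadSystem.linearizesQuad_of_chart hJ
  exact ⟨φ, hp, hsub, hφ, hφ', hlin,
    ThirdOrder.linearizesCubic_of_linearizesQuad hΩ hG harises hsub hlin⟩
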